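/- Let $(q)_n=\prod_{k=1}^n(1-q^k)$, let $\begin{bmatrix} n\\ k\end{bmatrix}=\frac{(q)_n}{(q)_k(q)_{n-k}}$ for $0\le k\le n$ and $0$ otherwise be the Gaussian polynomial, and let $$S_n(q)=\sum_{k=0}^{\lfloor n/2\rfloor}q^{2k^2}\begin{bmatrix} n\\ 2k\end{bmatrix},\qquad T_n(q)=\sum_{k=0}^{\lfloor (n-1)/2\rfloor}q^{2k(k+1)}\begin{bmatrix} n\\ 2k+1\end{bmatrix}$$ be the Santos polynomials. Define the formal series $$X^{(0)}(q)=\sum_{n=0}^\infty (q)_n\,(T_n(q)+T_{n+1}(q)),\qquad X^{(1)}(q)=\sum_{n=0}^\infty (q)_n\,(S_n(q)+S_{n+1}(q)).$$ Let $\chi_{24}^{(0)},\chi_{24}^{(1)}$ be the functions of period $24$ on the integers such that $\chi_{24}^{(0)}(n)$ is $1$ for $n\equiv 5,19$, is $-1$ for $n\equiv 11,13$, and is $0$ otherwise, and $\chi_{24}^{(1)}(n)$ is $1$ for $n\equiv 1,23$, is $-1$ for $n\equiv 7,17$, and is $0$ otherwise (all modulo $24$). Let $L(s,\chi_{24}^{(a)})$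 be the analytic continuation of $\sum_{m\ge1}\chi_{24}^{(a)}(m)m^{-s}$, and put $$t_n^{(a)}=\tfrac12(-1)^{n+1}L(-2n-1,\chi_{24}^{(a)})\qquad(a=0,1,\ n\ge0).$$ Then, as $z\searrow0$, there are the asymptotic expansions $$X^{(0)}(e^{-z})= e^{25z/48}\sum_{n=0}^\infty\frac{t_n^{(0)}}{n!}\Big(\frac z{48}\Big)^n,\qquad X^{(1)}(e^{-z})= e^{z/48}\sum_{n=0}^\infty\frac{t_n^{(1)}}{n!}\Big(\frac z{48}\Big)^n .$$ These are meant in the following sense (the series $X^{(a)}(q)$ do not converge for $0<q<1$). With $q=e^{-z}$, the series $X^{(a)}(e^{-z})$ converges $z$-adically in $\mathbb C[[z]]$, and its sum is the right-hand side. Moreover, for all $M\ge N\ge0$, the sum of the first $M$ terms of $X^{(a)}(e^{-z})$ differs from the right-hand side, with its sum restricted to $0\le n<N$, by $O(z^N)$ as $z\searrow0$ through real values. Moreover, for $a=0,1$ and all $n\ge0$, $$t_n^{(a)}=\frac12(-1)^n\,\frac{24^{2n+1}}{2n+2}\sum_{k=1}^{24}\chi_{24}^{(a)}(k)\,B_{2n+2}\!\left(\frac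 k{24}\right),$$ where $B_m(x)$ is the $m$-th Bernoulli polynomial. -/

import Mathlib

noncomputable section

open Polynomial

namespace Santos

/-- The `q`-product `(q)_n = ∏_{k=1}^n (1 - q^k)`, as a polynomial in `q`. -/
def qProd (n : ℕ) : ℤ[X] := ∏ k ∈ Finset.range n, (1 - X ^ (k + 1))

/-- The Gaussian polynomial (`q`-binomial coefficient), by the `q`-Pascal rule.
`gauss_mul` and `gauss_eq_zero` say that it is `(q)_n / ((q)_k (q)_{n-k})` for `k ≤ n` and `0`
otherwise. -/
def gauss : ℕ → ℕ → ℤ[X]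
  | _, 0 => 1
  | 0, _ + 1 => 0
  | n + 1, k + 1 => gauss n k + X ^ (k + 1) * gauss n (k + 1)

theorem gauss_eq_zero : ∀ {n k : ℕ}, n < k → gauss n k = 0
  | _, 0, h => absurd h (Nat.not_lt_zero _)
  | 0, _ + 1, _ => by simp [gauss]
  | n + 1, k + 1, h => by
    rw [gauss, gauss_eq_zero (show n < k by omega), gauss_eq_zero (show n < k + 1 by omega)]
    simp

theorem qProd_succ (n : ℕ) : qProd (n + 1) = qProd n * (1 - X ^ (n + 1)) :=
  Finset.prod_range_succ _ _

theorem gauss_add_mul : ∀ n k m : ℕ, k + m = n → gauss n k * (qProd k * qProd m) = qProd n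
  | _, 0, m, h => by
    obtain rfl : m = _ := by simpa using h
    simp [gauss, qProd]
  | 0, k + 1, m, h => by omega
  | n + 1, k + 1, 0, h => by
    have hk : k = n := by omega
    subst hk
    have ih := gauss_add_mul k k 0 (by omega)
    rw [gauss, gauss_eq_zero (show k < k + 1 by omega), qProd_succ]
    linear_combination (1 - X ^ (k + 1)) * ih
  | n + 1, k + 1, m + 1, h => by
    have h1 := gauss_add_mul n k (m + 1) (by omega)
    have h2 := gauss_add_mul n (k + 1) m (by omega)
    have hn : n = k + m + 1 := by omega
    rw [qProd_succ] at h1 h2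
    rw [gauss, qProd_succ k, qProd_succ m, qProd_succ n]
    have h3 : (X : ℤ[X]) ^ (n + 1) = X ^ (k + 1) * X ^ (m + 1) := by
      rw [hn]; ring
    rw [h3]
    linear_combination (1 - X ^ (k + 1)) * h1 + X ^ (k + 1) * (1 - X ^ (m + 1)) * h2

theorem gauss_mul {n k : ℕ} (h : k ≤ n) :
    gauss n k * (qProd k * qProd (n - k)) = qProd n :=
  gauss_add_mul n k (n - k) (by omega)

/-- Santos polynomial `S_n(q) = ∑_{k=0}^{⌊n/2⌋} q^{2k²} [n, 2k]`. -/
def S (n : ℕ) : ℤ[X] :=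
  ∑ k ∈ Finset.range (n / 2 + 1), X ^ (2 * k ^ 2) * gauss n (2 * k)

/-- Santos polynomial `T_n(q) = ∑_{k=0}^{⌊(n-1)/2⌋} q^{2k(k+1)} [n, 2k+1]`.  The number of terms
is `⌊(n-1)/2⌋ + 1 = ⌊(n+1)/2⌋`; in particular `T_0 = 0`. -/
def T (n : ℕ) : ℤ[X] :=
  ∑ k ∈ Finset.range ((n + 1) / 2), X ^ (2 * k * (k + 1)) * gauss n (2 * k + 1)

/-- The `n`-th term of the formal series `X⁽⁰⁾(q) = ∑ (q)_n (T_n + T_{n+1})`. -/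
def term0 (n : ℕ) : ℤ[X] := qProd n * (T n + T (n + 1))

/-- The `n`-th term of the formal series `X⁽¹⁾(q) = ∑ (q)_n (S_n + S_{n+1})`. -/
def term1 (n : ℕ) : ℤ[X] := qProd n * (S n + S (n + 1))

/-- The 24-periodic function `χ₂₄⁽⁰⁾`. -/
def chi0 (n : ZMod 24) : ℂ :=
  if n = 5 ∨ n = 19 then 1 else if n = 11 ∨ n = 13 then -1 else 0

/-- The 24-periodic function `χ₂₄⁽¹⁾`. -/
def chi1 (n : ZMod 24) : ℂ :=
  if n = 1 ∨ n = 23 then 1 else if n = 7 ∨ n = 17 then -1 else 0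

/-- `t_n = ½ (-1)^{n+1} L(-2n-1, χ)`, with `L(s, χ)` the analytic continuation of
`∑_{m ≥ 1} χ(m) m^{-s}`. -/
def tSeries (χ : ZMod 24 → ℂ) (n : ℕ) : ℂ :=
  1 / 2 * (-1) ^ (n + 1) * ZMod.LFunction χ (-2 * (n : ℂ) - 1)

/-- The formal power series `e^{cz}` in `ℂ⟦z⟧`. -/
def expSeries (c : ℂ) : PowerSeries ℂ := PowerSeries.rescale c (PowerSeries.exp ℂ)

/-- `∑ f n = F` in `ℂ⟦z⟧` with its `z`-adic topology: modulo every power of `z`, the partial sums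
are eventually equal to `F`. -/
def HasFormalSum (f : ℕ → PowerSeries ℂ) (F : PowerSeries ℂ) : Prop :=
  ∀ N : ℕ, ∃ M₀ : ℕ, ∀ M ≥ M₀, (PowerSeries.X : PowerSeries ℂ) ^ N ∣ F - ∑ n ∈ Finset.range M, f n

/-- The series `∑ p n (q)` of polynomials in `q` has at `q = e^{-z}`, `z ↘ 0`, the asymptotic
expansion `e^{cz} ∑ a n z^n`: the equality holds in `ℂ⟦z⟧` (first part), and for each `N`, all
partial sums with at least `N` terms agree with the expansion up to `O(z^N)` for real `z ↘ 0`
(second part). -/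
def HasExpansion (p : ℕ → ℤ[X]) (c : ℂ) (a : ℕ → ℂ) : Prop :=
  HasFormalSum (fun n => aeval (expSeries (-1)) (p n)) (expSeries c * PowerSeries.mk a) ∧
  ∀ N : ℕ, ∀ M ≥ N,
    (fun z : ℝ => ∑ n ∈ Finset.range M, aeval (Complex.exp (-(z : ℂ))) (p n)
        - Complex.exp (c * z) * ∑ n ∈ Finset.range N, a n * (z : ℂ) ^ n)
      =O[nhdsWithin 0 (Set.Ioi 0)] fun z : ℝ => z ^ N

end Santos

end

/-! Put `p = q^{1/2}`. The `q`-binomial theorem gives `S_n - p T_n = (p; p²)_n`; multiplied by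
`(q)_n`, it turns `X⁽¹⁾(p²) - p X⁽⁰⁾(p²)` into the Kontsevich–Zagier series `∑ (p; p)_m`
(`sum_aeval_term1_sub_term0`). Its expansions at `p = e^{-z/2}` and `p = -e^{-z/2}` yield `X⁽¹⁾` and
`X⁽⁰⁾` as half-sum and half-difference.

These expansions are Zagier's strange identity, proved formally. The series `Z(x) = ∑ x^m (x;
p)_{m+1}` satisfies `Z(x) + p²x³ Z(px) = 1 - px²` up to a remainder. With `x = e^{-uz}` everything
lies in `ℂ[u]⟦z⟧`, and `x ↦ px` or `x ↦ p²x` is a translation of `u`. A regularized theta series `∑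
χ(n) e^{-(nu/2 + n²/48)z}`, with `n^k` summed to `L(-k, χ)`, obeys the same equation after the
factor `e^{-(u/2 + 1/48)z}` is included, because `χ` changes sign under translation by 6 or 12. The
equation has only one solution (`X_pow_dvd_of_shift`): no nonzero polynomial satisfies `d(u + s) =
-d(u)`. Comparing coefficients of `u` gives `∑ (p; p)_m` on one side and odd moments of `χ` on the
other (`X_pow_dvd_sum_qPoch_sub`).

The analytic statement follows from the formal one, since each partial sum is a polynomial in
`e^{-z}`. -/

namespace Santos

open Polynomial PowerSeries

/-! ### Finite `q`-series identities. -/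

section RingIdentities

variable {R : Type*} [CommRing R]

/-- The `q`-binomial theorem, in the variable `p = q^{1/2}`. -/
theorem sum_gauss_eq_prod [Algebra ℤ R] (p : R) (n : ℕ) (y : R) :
    ∑ j ∈ Finset.range (n + 1), (-y) ^ j * p ^ (j ^ 2) * aeval (p ^ 2) (gauss n j) =
      ∏ k ∈ Finset.range n, (1 - y * p ^ (2 * k + 1)) := by
  induction n generalizing y with
  | zero => simp [gauss]
  | succ n ih =>
    -- Splitting off the factor `1 - y p` leaves the product of length `n` at `p² y`; the `q`-Pascal
    -- rule splits the sum in the same way.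
    have h := ih (p ^ 2 * y)
    rw [Finset.prod_range_succ']
    have hprod : ∏ k ∈ Finset.range n, (1 - y * p ^ (2 * (k + 1) + 1)) =
        ∏ k ∈ Finset.range n, (1 - p ^ 2 * y * p ^ (2 * k + 1)) :=
      Finset.prod_congr rfl fun k _ => by ring
    rw [hprod, ← h, Finset.sum_range_succ']
    have hstep : ∀ j, (-y) ^ (j + 1) * p ^ ((j + 1) ^ 2) * aeval (p ^ 2) (gauss (n + 1) (j + 1)) =
        (-(p ^ 2 * y)) ^ j * p ^ (j ^ 2) * aeval (p ^ 2) (gauss n j) * (-(y * p)) +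
        (-(p ^ 2 * y)) ^ (j + 1) * p ^ ((j + 1) ^ 2) * aeval (p ^ 2) (gauss n (j + 1)) := by
      intro j
      rw [gauss]
      simp only [map_add, map_mul, map_pow, aeval_X]
      ring
    simp only [hstep, Finset.sum_add_distrib, ← Finset.sum_mul]
    have hlast : ∑ j ∈ Finset.range (n + 1),
        (-(p ^ 2 * y)) ^ (j + 1) * p ^ ((j + 1) ^ 2) * aeval (p ^ 2) (gauss n (j + 1)) =
        ∑ j ∈ Finset.range (n + 1), (-(p ^ 2 * y)) ^ j * p ^ (j ^ 2) * aeval (p ^ 2) (gauss n j)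
          - 1 := by
      rw [Finset.sum_range_succ, gauss_eq_zero (Nat.lt_succ_self n), Finset.sum_range_succ']
      simp [gauss]
    rw [hlast]
    simp [gauss]
    ring

theorem sum_range_even_odd (f : ℕ → R) (n : ℕ) :
    ∑ j ∈ Finset.range (n + 1), f j =
      ∑ k ∈ Finset.range (n / 2 + 1), f (2 * k) +
        ∑ k ∈ Finset.range ((n + 1) / 2), f (2 * k + 1) := by
  induction n with
  | zero => simp
  | succ n ih =>
    rw [Finset.sum_range_succ, ih]
    rcases Nat.even_or_odd' n with ⟨m, rfl | rfl⟩
    · rw [show (2 * m + 1) / 2 = m by omega, show 2 * m / 2 = m by omega,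
        show (2 * m + 1 + 1) / 2 = m + 1 by omega, Finset.sum_range_succ _ m,
        Finset.sum_range_succ (fun k => f (2 * k + 1)) m]
      ring
    · rw [show (2 * m + 1) / 2 = m by omega, show (2 * m + 1 + 1) / 2 = m + 1 by omega,
        show (2 * m + 1 + 1 + 1) / 2 = m + 1 by omega, Finset.sum_range_succ _ (m + 1)]
      ring_nf

theorem aeval_S_sub_T [Algebra ℤ R] (p : R) (n : ℕ) :
    aeval (p ^ 2) (S n) - p * aeval (p ^ 2) (T n) =
      ∏ k ∈ Finset.range n, (1 - p ^ (2 * k + 1)) := by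
  have h := sum_gauss_eq_prod p n 1
  simp only [one_mul] at h
  rw [← h, sum_range_even_odd, S, T]
  simp only [map_sum, map_mul, map_pow, aeval_X, sub_eq_add_neg, Finset.mul_sum,
    ← Finset.sum_neg_distrib]
  congr 1
  · refine Finset.sum_congr rfl fun k _ => ?_
    rw [pow_mul (-1 : R) 2 k]
    ring
  · refine Finset.sum_congr rfl fun k _ => ?_
    rw [pow_succ (-1 : R), pow_mul (-1 : R) 2 k]
    ring

/-- The finite product `(y; p)_n`. -/
def qPoch (p y : R) (n : ℕ) : R := ∏ k ∈ Finset.range n, (1 - y * p ^ k)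

theorem qPoch_succ (p y : R) (n : ℕ) : qPoch p y (n + 1) = qPoch p y n * (1 - y * p ^ n) :=
  Finset.prod_range_succ _ _

theorem qPoch_succ' (p y : R) (n : ℕ) : qPoch p y (n + 1) = (1 - y) * qPoch p (p * y) n := by
  rw [qPoch, Finset.prod_range_succ', mul_comm]
  simp only [pow_zero, mul_one, qPoch]
  congr 1
  exact Finset.prod_congr rfl fun k _ => by ring

theorem qPoch_two_mul [Algebra ℤ R] (p : R) (n : ℕ) :
    qPoch p p (2 * n) =
      aeval (p ^ 2) (qProd n) * ∏ k ∈ Finset.range n, (1 - p ^ (2 * k + 1)) := by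
  induction n with
  | zero => simp [qPoch, qProd]
  | succ n ih =>
    rw [show 2 * (n + 1) = 2 * n + 1 + 1 by ring, qPoch_succ, qPoch_succ, ih, qProd_succ,
      Finset.prod_range_succ]
    simp only [map_mul, map_sub, map_one, map_pow, aeval_X]
    ring

/-- `(p²; p²)_n` interlaces with `(p; p²)_n` to form `(p; p)_{2n}`, and with `(p; p²)_{n+1}` to form
`(p; p)_{2n+1}`. This is why consecutive Santos polynomials are added. -/
theorem aeval_term1_sub_term0 [Algebra ℤ R] (p : R) (n : ℕ) :
    aeval (p ^ 2) (term1 n) - p * aeval (p ^ 2) (term0 n) =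
      qPoch p p (2 * n) + qPoch p p (2 * n + 1) := by
  have h1 := aeval_S_sub_T p n
  have h2 := aeval_S_sub_T p (n + 1)
  rw [Finset.prod_range_succ] at h2
  rw [qPoch_succ, qPoch_two_mul]
  simp only [term0, term1, map_mul, map_add]
  linear_combination aeval (p ^ 2) (qProd n) * (h1 + h2)

theorem sum_aeval_term1_sub_term0 [Algebra ℤ R] (p : R) (M : ℕ) :
    ∑ n ∈ Finset.range M, aeval (p ^ 2) (term1 n) -
        p * ∑ n ∈ Finset.range M, aeval (p ^ 2) (term0 n) =
      ∑ m ∈ Finset.range (2 * M), qPoch p p m := by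
  induction M with
  | zero => simp
  | succ M ih =>
    rw [show 2 * (M + 1) = 2 * M + 1 + 1 by ring, Finset.sum_range_succ, Finset.sum_range_succ,
      Finset.sum_range_succ, Finset.sum_range_succ, ← ih]
    linear_combination aeval_term1_sub_term0 p M

/-- Partial sums of Zagier's series `∑ (x; p)_{m+1} x^m`. -/
def zagierSum (p x : R) (M : ℕ) : R := ∑ m ∈ Finset.range M, x ^ m * qPoch p x (m + 1)

theorem zagierSum_succ (p x : R) (M : ℕ) :
    zagierSum p x (M + 1) = zagierSum p x M + x ^ M * qPoch p x (M + 1) :=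
  Finset.sum_range_succ _ _

theorem zagierSum_eq (p x : R) (M : ℕ) :
    zagierSum p x M = (1 - x) * ∑ m ∈ Finset.range M, x ^ m * qPoch p (p * x) m := by
  rw [zagierSum, Finset.mul_sum]
  refine Finset.sum_congr rfl fun m _ => ?_
  rw [qPoch_succ']
  ring

/-- Taking one term fewer at `p x` than at `x` leaves a single remainder, which makes the induction
on `M` a one-line computation. -/
theorem zagierSum_functional (p x : R) (M : ℕ) :
    zagierSum p x (M + 1) + p ^ 2 * x ^ 3 * zagierSum p (p * x) M =
      1 - p * x ^ 2 - x ^ (M + 1) * qPoch p (p * x) (M + 1) := by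
  induction M with
  | zero =>
    simp [zagierSum, qPoch]
    ring
  | succ M ih =>
    rw [zagierSum_succ p x, zagierSum_succ p (p * x), qPoch_succ' p x,
      qPoch_succ p (p * x) (M + 1)]
    linear_combination ih

/-- Needed for `p = -e^{-z/2}`: there `x ↦ p x` changes the constant term of `x`, and only `x ↦ p²
x` is a translation of `u`. -/
theorem zagierSum_functional_two (p x : R) (M : ℕ) :
    zagierSum p x (M + 2) - p ^ 7 * x ^ 6 * zagierSum p (p ^ 2 * x) M =
      1 - p * x ^ 2 - p ^ 2 * x ^ 3 + p ^ 5 * x ^ 5 - x ^ (M + 2) * qPoch p (p * x) (M + 2)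
        + p ^ 2 * x ^ 3 * (p * x) ^ (M + 1) * qPoch p (p * (p * x)) (M + 1) := by
  have h1 := zagierSum_functional p x (M + 1)
  have h2 := zagierSum_functional p (p * x) M
  rw [show p ^ 2 * x = p * (p * x) by ring]
  linear_combination h1 - p ^ 2 * x ^ 3 * h2

theorem map_zagierSum {R' : Type*} [CommRing R'] (f : R →+* R') (p x : R) (M : ℕ) :
    f (zagierSum p x M) = zagierSum (f p) (f x) M := by
  simp [zagierSum, qPoch, map_sum, map_prod]

end RingIdentities

/-! ### Small remainders and uniqueness for the functional equation. -/

section Divisibility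

variable {R : Type*} [CommRing R]

/-- Of any two consecutive factors `1 - y p^k` at least one has zero constant term: the one with `k`
even or the one with `k` odd, according to the case of `hy`. -/
theorem X_pow_dvd_qPoch {p y : R⟦X⟧} (hp : constantCoeff p ^ 2 = 1)
    (hy : constantCoeff y = 1 ∨ constantCoeff y * constantCoeff p = 1) {K m : ℕ}
    (h : 2 * K ≤ m) : (PowerSeries.X : R⟦X⟧) ^ K ∣ qPoch p y m := by
  have key : (PowerSeries.X : R⟦X⟧) ^ K ∣ qPoch p y (2 * K) := by
    clear h
    induction K with
    | zero => simp
    | succ K ih =>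
      rw [show 2 * (K + 1) = 2 * K + 1 + 1 by ring, qPoch_succ, qPoch_succ, mul_assoc, pow_succ]
      refine mul_dvd_mul ih (PowerSeries.X_dvd_iff.2 ?_)
      simp only [map_mul, map_sub, map_one, map_pow, pow_succ, pow_mul]
      simp only [pow_two] at hp
      rcases hy with hy | hy <;> simp [hp, hy]
  refine key.trans ?_
  rw [qPoch, qPoch]
  exact Finset.prod_dvd_prod_of_subset _ _ _ (Finset.range_subset_range.2 h)

/-- After division by the power of `z` already obtained, the constant coefficient `d` satisfies `d(u
+ s) = -d(u)`. Translation preserves the leading coefficient, so `d = 0`. -/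
theorem X_pow_dvd_of_shift {s : ℂ} {U D : ℂ[X]⟦X⟧} (hU : constantCoeff U = 1) {K : ℕ}
    (h : (PowerSeries.X : ℂ[X]⟦X⟧) ^ K ∣
      D + U * PowerSeries.map (compRingHom (Polynomial.X + Polynomial.C s)) D) :
    (PowerSeries.X : ℂ[X]⟦X⟧) ^ K ∣ D := by
  induction K with
  | zero => simp
  | succ K ih =>
    obtain ⟨D', rfl⟩ := ih ((pow_dvd_pow _ (Nat.le_succ K)).trans h)
    rw [map_mul, map_pow, PowerSeries.map_X, pow_succ, mul_left_comm, ← mul_add] at h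
    have h' := (mul_dvd_mul_iff_left (pow_ne_zero K PowerSeries.X_ne_zero)).1 h
    rw [pow_succ]
    refine mul_dvd_mul_left _ ?_
    rw [PowerSeries.X_dvd_iff] at h' ⊢
    simp only [map_add, map_mul, hU, one_mul, ← PowerSeries.coeff_zero_eq_constantCoeff_apply,
      PowerSeries.coeff_map] at h' ⊢
    set d := PowerSeries.coeff 0 D'
    have hd : taylor s d = -d := by
      rw [taylor_apply]
      exact eq_neg_of_add_eq_zero_right h'
    have hl : (taylor s d).leadingCoeff = d.leadingCoeff := leadingCoeff_taylor ..
    rw [hd, leadingCoeff_neg] at hl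
    exact leadingCoeff_eq_zero.1 (self_eq_neg.1 hl.symm)

end Divisibility

/-! ### Formal exponentials. -/

section Exponential

variable {R : Type*} [CommRing R] [Algebra ℚ R]

/-- The power series `e^{az}`. -/
noncomputable def expS (a : R) : R⟦X⟧ := rescale a (PowerSeries.exp R)

theorem expS_add (a b : R) : expS (a + b) = expS a * expS b :=
  (exp_mul_exp_eq_exp_add a b).symm

theorem expS_zero : expS (0 : R) = 1 := by
  simp [expS, rescale_zero]

theorem expS_pow (a : R) (n : ℕ) : expS a ^ n = expS (n * a) := by
  induction n with
  | zero => simp [expS_zero]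
  | succ n ih => rw [pow_succ, ih, ← expS_add]; push_cast; ring_nf

theorem coeff_expS (a : R) (n : ℕ) :
    PowerSeries.coeff n (expS a) = a ^ n * algebraMap ℚ R (1 / n.factorial) := by
  simp [expS, coeff_rescale, PowerSeries.coeff_exp]

theorem constantCoeff_expS (a : R) : constantCoeff (expS a) = 1 := by
  rw [← PowerSeries.coeff_zero_eq_constantCoeff_apply, coeff_expS]; simp

theorem map_expS {R' : Type*} [CommRing R'] [Algebra ℚ R'] (f : R →+* R') (a : R) :
    PowerSeries.map f (expS a) = expS (f a) := by
  ext n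
  rw [PowerSeries.coeff_map, coeff_expS, coeff_expS, map_mul, map_pow]
  congr 1
  exact RingHom.congr_fun (Subsingleton.elim (f.comp (algebraMap ℚ R)) (algebraMap ℚ R')) _

end Exponential

/-! ### Regularized sums and the theta series. -/

section Regularized

/-- The functional `n ^ k ↦ ℓ k` on polynomials in `n`, linear over the coefficient ring `ℂ[u]`. -/
noncomputable def regSum (ℓ : ℕ → ℂ) : ℂ[X][X] →ₗ[ℂ[X]] ℂ[X] :=
  Polynomial.lsum fun k => Polynomial.C (ℓ k) • LinearMap.id

theorem regSum_monomial (ℓ : ℕ → ℂ) (k : ℕ) (a : ℂ[X]) :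
    regSum ℓ (Polynomial.monomial k a) = Polynomial.C (ℓ k) * a := by
  simp [regSum, Polynomial.lsum_apply, Polynomial.sum_monomial_index]

theorem regSum_C_mul (ℓ : ℕ → ℂ) (a : ℂ[X]) (P : ℂ[X][X]) :
    regSum ℓ (Polynomial.C a * P) = a * regSum ℓ P := by
  rw [← Polynomial.smul_eq_C_mul, map_smul, smul_eq_mul]

theorem regSum_X_pow (ℓ : ℕ → ℂ) (k : ℕ) :
    regSum ℓ (Polynomial.X ^ k) = Polynomial.C (ℓ k) := by
  rw [Polynomial.X_pow_eq_monomial, regSum_monomial, mul_one]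

/-- `ℓ k` is a regularized value of `∑ χ(n) n ^ k`, where `χ(n + b) = - χ(n)` and the part of `χ`
on the first half-period is given by `I` and `c`. -/
def IsRegularized (ℓ : ℕ → ℂ) (b : ℂ) (I : Finset ℕ) (c : ℕ → ℂ) : Prop :=
  PowerSeries.mk (fun k => ℓ k / k.factorial) * (1 + expS b) =
    ∑ i ∈ I, PowerSeries.C (c i) * expS (i : ℂ)

theorem IsRegularized.recurrence {ℓ : ℕ → ℂ} {b : ℂ} {I : Finset ℕ} {c : ℕ → ℂ}
    (h : IsRegularized ℓ b I c) (k : ℕ) :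
    ℓ k + ∑ m ∈ Finset.range (k + 1), b ^ (k - m) * k.choose m * ℓ m =
      ∑ i ∈ I, c i * (i : ℂ) ^ k := by
  have hk := congrArg (PowerSeries.coeff k) h
  have hf : (k.factorial : ℂ) ≠ 0 := by exact_mod_cast k.factorial_ne_zero
  rw [mul_add, mul_one, map_add, PowerSeries.coeff_mk, PowerSeries.coeff_mul,
    Finset.Nat.sum_antidiagonal_eq_sum_range_succ_mk, map_sum] at hk
  simp only [PowerSeries.coeff_mk, PowerSeries.coeff_C_mul, coeff_expS] at hk
  have hk' := congrArg (fun t => (k.factorial : ℂ) * t) hk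
  simp only [mul_add, Finset.mul_sum] at hk'
  convert hk' using 2
  · field_simp
  · refine Finset.sum_congr rfl fun m hm => ?_
    have hm' : m ≤ k := Nat.lt_succ_iff.1 (Finset.mem_range.1 hm)
    have h1 : (m.factorial : ℂ) ≠ 0 := by exact_mod_cast m.factorial_ne_zero
    have h2 : ((k - m).factorial : ℂ) ≠ 0 := by exact_mod_cast (k - m).factorial_ne_zero
    rw [Nat.cast_choose ℂ hm']
    simp
    field_simp
  · simp
    field_simp

/-- Formally, translation by the antiperiod `b` cancels everything except the first half-period. On
monomials this is `IsRegularized.recurrence`. -/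
theorem IsRegularized.regSum_add_comp {ℓ : ℕ → ℂ} {b : ℂ} {I : Finset ℕ} {c : ℕ → ℂ}
    (h : IsRegularized ℓ b I c) (P : ℂ[X][X]) :
    regSum ℓ P + regSum ℓ (P.comp (Polynomial.X + Polynomial.C (Polynomial.C b))) =
      ∑ i ∈ I, Polynomial.C (c i) * P.eval (i : ℂ[X]) := by
  induction P using Polynomial.induction_on' with
  | add P Q hP hQ =>
    simp only [Polynomial.add_comp, map_add, Polynomial.eval_add, mul_add, Finset.sum_add_distrib,
      ← hP, ← hQ]
    ring
  | monomial k a =>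
    rw [regSum_monomial, Polynomial.monomial_comp, regSum_C_mul, add_pow, map_sum]
    have hterm : ∀ m ∈ Finset.range (k + 1), regSum ℓ (Polynomial.X ^ m *
        Polynomial.C (Polynomial.C b) ^ (k - m) * ((k.choose m : ℕ) : ℂ[X][X])) =
        Polynomial.C (b ^ (k - m) * k.choose m * ℓ m) := by
      intro m _
      rw [show Polynomial.X ^ m * Polynomial.C (Polynomial.C b) ^ (k - m) *
          ((k.choose m : ℕ) : ℂ[X][X]) = Polynomial.C (Polynomial.C (b ^ (k - m) * k.choose m)) *
          Polynomial.X ^ m by simp; ring, regSum_C_mul, regSum_X_pow, ← Polynomial.C_mul]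
    rw [Finset.sum_congr rfl hterm, ← map_sum, mul_comm (Polynomial.C (ℓ k)), ← mul_add,
      ← Polynomial.C_add, h.recurrence k, map_sum, Finset.mul_sum]
    refine Finset.sum_congr rfl fun i _ => ?_
    simp
    ring

/-- `regSum`, applied to each coefficient of a power series. -/
noncomputable def regSer (ℓ : ℕ → ℂ) (F : ℂ[X][X]⟦X⟧) : ℂ[X]⟦X⟧ :=
  PowerSeries.mk fun k => regSum ℓ (PowerSeries.coeff k F)

theorem regSer_map_C_mul (ℓ : ℕ → ℂ) (f : ℂ[X]⟦X⟧) (F : ℂ[X][X]⟦X⟧) :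
    regSer ℓ (PowerSeries.map Polynomial.C f * F) = f * regSer ℓ F := by
  ext1 k
  simp only [regSer, PowerSeries.coeff_mk, PowerSeries.coeff_mul, map_sum, PowerSeries.coeff_map,
    regSum_C_mul]

/-- The substitution `u ↦ u + s` in `ℂ[u]`. -/
noncomputable abbrev shift (s : ℂ) : ℂ[X] →+* ℂ[X] :=
  compRingHom (Polynomial.X + Polynomial.C s)

theorem map_shift_expS_C (s a : ℂ) :
    PowerSeries.map (shift s) (expS (Polynomial.C a)) = expS (Polynomial.C a) := by
  rw [map_expS, coe_compRingHom_apply, Polynomial.C_comp]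

theorem regSer_map_mapRingHom_shift (ℓ : ℕ → ℂ) (s : ℂ) (F : ℂ[X][X]⟦X⟧) :
    regSer ℓ (PowerSeries.map (Polynomial.mapRingHom (shift s)) F) =
      PowerSeries.map (shift s) (regSer ℓ F) := by
  ext1 k
  simp only [regSer, PowerSeries.coeff_mk, PowerSeries.coeff_map]
  induction PowerSeries.coeff k F using Polynomial.induction_on' with
  | add P Q hP hQ => simp only [map_add, hP, hQ]
  | monomial k a => simp [regSum_monomial]

/-- The exponent `- (n u / 2 + n ^ 2 / 48)`, with `n` the outer and `u` the inner variable. -/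
noncomputable def thetaExponent : ℂ[X][X] :=
  -(Polynomial.X * Polynomial.C (Polynomial.C (1 / 2) * Polynomial.X) +
    Polynomial.X ^ 2 * Polynomial.C (Polynomial.C (1 / 48)))

/-- The regularization of `∑ χ(n) e^{-(n u / 2 + n ^ 2 / 48) z}`. -/
noncomputable def thetaSer (ℓ : ℕ → ℂ) : ℂ[X]⟦X⟧ := regSer ℓ (expS thetaExponent)

/-- Completing the square: translating `n` by `12 s` amounts to translating `u` by `s`, up to a term
free of `n`. -/
theorem thetaExponent_comp (s : ℂ) :
    thetaExponent.comp (Polynomial.X + Polynomial.C (Polynomial.C (12 * s))) =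
      Polynomial.C (-(Polynomial.C (6 * s) * Polynomial.X + Polynomial.C (3 * s ^ 2))) +
        Polynomial.mapRingHom (shift s) thetaExponent := by
  have e1 : (Polynomial.C (1 / 2 : ℂ)) * Polynomial.C (12 * s) = Polynomial.C (6 * s) := by
    rw [← Polynomial.C_mul]; congr 1; ring
  have e2 : (Polynomial.C (1 / 48 : ℂ)) * Polynomial.C (12 * s) ^ 2 = Polynomial.C (3 * s ^ 2) := by
    rw [← Polynomial.C_pow, ← Polynomial.C_mul]; congr 1; ring
  have e3 : (Polynomial.C (1 / 48 : ℂ)) * Polynomial.C (12 * s) * 2 =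
      Polynomial.C (1 / 2) * Polynomial.C s := by
    rw [← Polynomial.C_mul, ← Polynomial.C_mul, show (2 : ℂ[X]) = Polynomial.C 2 from rfl,
      ← Polynomial.C_mul]; congr 1; ring
  have e1' := congrArg (Polynomial.C (R := ℂ[X])) e1
  have e2' := congrArg (Polynomial.C (R := ℂ[X])) e2
  have e3' := congrArg (Polynomial.C (R := ℂ[X])) e3
  simp only [thetaExponent, Polynomial.neg_comp, Polynomial.add_comp, Polynomial.mul_comp,
    Polynomial.X_comp, Polynomial.C_comp, Polynomial.pow_comp, Polynomial.coe_mapRingHom,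
    Polynomial.map_neg, Polynomial.map_add, Polynomial.map_mul, Polynomial.map_X,
    Polynomial.map_C, Polynomial.map_pow, coe_compRingHom_apply, Polynomial.C_neg,
    Polynomial.C_add, Polynomial.C_mul, map_ofNat] at e1' e2' e3' ⊢
  simp only [map_mul, map_pow, map_ofNat] at e1' e2' e3' ⊢
  linear_combination -e1' * Polynomial.C Polynomial.X - e2' - e3' * Polynomial.X

theorem IsRegularized.thetaSer_functional {ℓ : ℕ → ℂ} {s : ℂ} {I : Finset ℕ} {c : ℕ → ℂ}
    (h : IsRegularized ℓ (12 * s) I c) :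
    thetaSer ℓ + expS (-(Polynomial.C (6 * s) * Polynomial.X + Polynomial.C (3 * s ^ 2))) *
        PowerSeries.map (shift s) (thetaSer ℓ) =
      ∑ i ∈ I, PowerSeries.C (Polynomial.C (c i)) *
        expS (-(Polynomial.C (i / 2 : ℂ) * Polynomial.X + Polynomial.C (i ^ 2 / 48 : ℂ))) := by
  rw [thetaSer, ← regSer_map_mapRingHom_shift, ← regSer_map_C_mul, map_expS, map_expS, ← expS_add,
    ← thetaExponent_comp, ← Polynomial.coe_compRingHom_apply, ← map_expS]
  ext1 k
  rw [map_add, regSer, regSer, PowerSeries.coeff_mk, PowerSeries.coeff_mk, PowerSeries.coeff_map,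
    coe_compRingHom_apply, h.regSum_add_comp, map_sum]
  refine Finset.sum_congr rfl fun i _ => ?_
  rw [PowerSeries.coeff_C_mul, ← Polynomial.coe_evalRingHom, ← PowerSeries.coeff_map, map_expS]
  congr 3
  simp only [thetaExponent, Polynomial.coe_evalRingHom, Polynomial.eval_neg, Polynomial.eval_add,
    Polynomial.eval_mul, Polynomial.eval_X, Polynomial.eval_C, Polynomial.eval_pow, div_eq_mul_inv,
    Polynomial.C_mul, Polynomial.C_pow, one_mul, Polynomial.C_eq_natCast]
  ring

end Regularized

/-! ### The coefficient of `u`. -/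

section LinearCoefficient

/-- The coefficient of `u` in a power series over `ℂ[u]`. -/
noncomputable def linCoeff (f : ℂ[X]⟦X⟧) : ℂ⟦X⟧ :=
  PowerSeries.mk fun k => (PowerSeries.coeff k f).coeff 1

theorem linCoeff_sub (f g : ℂ[X]⟦X⟧) : linCoeff (f - g) = linCoeff f - linCoeff g := by
  ext1 k; simp [linCoeff]

theorem X_pow_dvd_linCoeff {K : ℕ} {f : ℂ[X]⟦X⟧} (h : (PowerSeries.X : ℂ[X]⟦X⟧) ^ K ∣ f) :
    (PowerSeries.X : ℂ⟦X⟧) ^ K ∣ linCoeff f := by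
  rw [PowerSeries.X_pow_dvd_iff] at h ⊢
  intro m hm
  simp [linCoeff, h m hm]

theorem linCoeff_C_X_mul (f : ℂ[X]⟦X⟧) :
    linCoeff (PowerSeries.C Polynomial.X * f) = PowerSeries.map (Polynomial.evalRingHom 0) f := by
  ext1 k
  simp [linCoeff, Polynomial.coeff_X_mul, Polynomial.coeff_zero_eq_eval_zero]

theorem exists_one_sub_expS : ∃ Y : ℂ[X]⟦X⟧, 1 - expS (-Polynomial.X) =
    PowerSeries.C Polynomial.X * Y ∧ PowerSeries.map (Polynomial.evalRingHom 0) Y =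
      PowerSeries.X := by
  refine ⟨PowerSeries.mk fun k => if k = 0 then 0 else
    (-1) ^ (k + 1) * Polynomial.X ^ (k - 1) * algebraMap ℚ ℂ[X] (1 / k.factorial), ?_, ?_⟩
  · ext1 k
    rcases k with _ | k
    · simp [constantCoeff_expS]
    · rw [map_sub, PowerSeries.coeff_C_mul, PowerSeries.coeff_mk, coeff_expS, PowerSeries.coeff_one]
      simp only [Nat.succ_ne_zero, if_false, Nat.add_sub_cancel]
      ring
  · ext1 k
    rcases k with _ | _ | k
    · simp
    · simp
    · simp [PowerSeries.coeff_X]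

/-- The asymptotic series `- 1 / 2 ∑ ℓ (2 k + 1) (-z / 48) ^ k / k!`. -/
noncomputable def halfDerivSer (ℓ : ℕ → ℂ) : ℂ⟦X⟧ :=
  PowerSeries.mk fun k => 1 / 2 * (-1) ^ (k + 1) * ℓ (2 * k + 1) / k.factorial * (1 / 48) ^ k

theorem coeff_one_regSum (ℓ : ℕ → ℂ) (k : ℕ) :
    (regSum ℓ (thetaExponent ^ (k + 1))).coeff 1 =
      (-1) ^ (k + 1) * (k + 1) * (1 / 2) * (1 / 48) ^ k * ℓ (2 * k + 1) := by
  have hexp : thetaExponent ^ (k + 1) = ∑ i ∈ Finset.range (k + 2),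
      Polynomial.C (Polynomial.C ((-1) ^ (k + 1) * (1 / 2) ^ i * (1 / 48) ^ (k + 1 - i) *
        ((k + 1).choose i : ℂ)) * Polynomial.X ^ i) * Polynomial.X ^ (k + 1 + (k + 1 - i)) := by
    have hfac : thetaExponent = Polynomial.C (Polynomial.C (-1)) * (Polynomial.X *
        (Polynomial.C (Polynomial.C (1 / 2) * Polynomial.X) +
          Polynomial.X * Polynomial.C (Polynomial.C (1 / 48)))) := by
      simp only [thetaExponent, map_neg, map_one]
      ring
    rw [hfac, mul_pow, mul_pow, add_pow, Finset.mul_sum, Finset.mul_sum]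
    refine Finset.sum_congr rfl fun i _ => ?_
    simp only [map_mul, map_pow, mul_pow, map_neg, map_one, pow_add, map_natCast]
    ring
  rw [hexp, map_sum, Polynomial.finsetSum_coeff,
    -- The index `i` is the power of `u`, so only `i = 1` contributes; the accompanying power of `n`
    -- is `2k + 1`.
    Finset.sum_eq_single 1]
  · rw [regSum_C_mul, regSum_X_pow, mul_assoc, Polynomial.coeff_C_mul, Polynomial.coeff_mul_C,
      Polynomial.coeff_X_pow, show k + 1 + (k + 1 - 1) = 2 * k + 1 by omega, if_pos rfl,
      Nat.add_sub_cancel, Nat.choose_one_right]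
    push_cast
    ring
  · intro i _ hi
    rw [regSum_C_mul, regSum_X_pow, mul_assoc, Polynomial.coeff_C_mul, Polynomial.coeff_mul_C,
      Polynomial.coeff_X_pow, if_neg (Ne.symm hi)]
    simp
  · simp

theorem linCoeff_thetaSer (ℓ : ℕ → ℂ) :
    linCoeff (thetaSer ℓ) = PowerSeries.X * halfDerivSer ℓ := by
  ext1 k
  rw [linCoeff, PowerSeries.coeff_mk, thetaSer, regSer, PowerSeries.coeff_mk, coeff_expS,
    show algebraMap ℚ ℂ[X][X] (1 / k.factorial) =
      Polynomial.C (Polynomial.C ((1 / k.factorial : ℚ) : ℂ)) from rfl, mul_comm, regSum_C_mul,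
    Polynomial.coeff_C_mul]
  rcases k with _ | k
  · have h0 : regSum ℓ 1 = Polynomial.C (ℓ 0) := by simpa using regSum_X_pow ℓ 0
    simp [h0]
  · rw [coeff_one_regSum, PowerSeries.coeff_succ_X_mul, halfDerivSer, PowerSeries.coeff_mk,
      Nat.factorial_succ]
    have h1 : (k.factorial : ℂ) ≠ 0 := by exact_mod_cast k.factorial_ne_zero
    have h2 : (k + 1 : ℂ) ≠ 0 := by exact_mod_cast k.succ_ne_zero
    push_cast
    field_simp

end LinearCoefficient

/-! ### Zagier's strange identity at `p = ±e^{-z/2}`. -/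

section StrangeIdentity

/-- The factor `1 - x = uz + O(u²)` in `zagierSum_eq` means that the coefficient of `u` sees the
rest only at `u = 0`, that is `x = 1`. Cancelling this `z` costs one order of precision. -/
theorem X_pow_dvd_sum_qPoch_sub {ℓ : ℕ → ℂ} {p : ℂ⟦X⟧} {K M : ℕ}
    (h : (PowerSeries.X : ℂ[X]⟦X⟧) ^ (K + 1) ∣
      expS (-(Polynomial.C (1 / 2) * Polynomial.X + Polynomial.C (1 / 48))) *
        zagierSum (PowerSeries.map Polynomial.C p) (expS (-Polynomial.X)) M - thetaSer ℓ) :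
    (PowerSeries.X : ℂ⟦X⟧) ^ K ∣
      ∑ m ∈ Finset.range M, qPoch p p m - expS (1 / 48) * halfDerivSer ℓ := by
  obtain ⟨Y, hY, hY'⟩ := exists_one_sub_expS
  have h1 := X_pow_dvd_linCoeff h
  have hp : PowerSeries.map (Polynomial.evalRingHom (0 : ℂ)) (PowerSeries.map Polynomial.C p)
      = p := by
    ext1 k; simp
  have hx : PowerSeries.map (Polynomial.evalRingHom (0 : ℂ)) (expS (-Polynomial.X)) = 1 := by
    rw [map_expS]; simp [expS_zero]
  rw [linCoeff_sub, zagierSum_eq, hY, mul_assoc, mul_left_comm, linCoeff_C_X_mul,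
    linCoeff_thetaSer, map_mul, map_mul, hY', map_sum, map_expS] at h1
  simp only [map_mul, map_pow, hx, one_pow, one_mul, qPoch, map_prod, map_sub, map_one, hp,
    mul_one] at h1
  rw [mul_left_comm, ← mul_sub, pow_succ', mul_dvd_mul_iff_left PowerSeries.X_ne_zero] at h1
  have hE : expS (1 / 48 : ℂ) * expS ((Polynomial.evalRingHom (0 : ℂ))
      (-(Polynomial.C (1 / 2) * Polynomial.X + Polynomial.C (1 / 48)))) = 1 := by
    rw [← expS_add, ← expS_zero]
    congr 1
    simp
  have h2 := h1.mul_left (expS (1 / 48 : ℂ))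
  rwa [mul_sub, ← mul_assoc, hE, one_mul] at h2

theorem thetaSer_congr_pos {ℓ : ℕ → ℂ}
    (h : IsRegularized ℓ 6 {1, 5} fun i => if i = 1 then 1 else -1) {K M : ℕ} (hM : 2 * K ≤ M) :
    (PowerSeries.X : ℂ[X]⟦X⟧) ^ K ∣
      expS (-(Polynomial.C (1 / 2) * Polynomial.X + Polynomial.C (1 / 48))) *
        zagierSum (PowerSeries.map Polynomial.C (expS (-1 / 2 : ℂ))) (expS (-Polynomial.X)) M
        - thetaSer ℓ := by
  rw [show (6 : ℂ) = 12 * (1 / 2) by norm_num] at h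
  have hθ := h.thetaSer_functional
  obtain ⟨U, hUdef⟩ : ∃ U : ℂ[X]⟦X⟧, U = expS (-(Polynomial.C (6 * (1 / 2)) * Polynomial.X +
      Polynomial.C (3 * (1 / 2) ^ 2))) := ⟨_, rfl⟩
  rw [← hUdef] at hθ
  refine X_pow_dvd_of_shift (s := 1 / 2) (U := U) (by rw [hUdef, constantCoeff_expS]) ?_
  change _ ∣ _ + _ * PowerSeries.map (shift (1 / 2)) _
  have hx : PowerSeries.map (shift (1 / 2)) (expS (-Polynomial.X)) =
      expS (Polynomial.C (-1 / 2)) * expS (-Polynomial.X) := by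
    rw [map_expS, ← expS_add]
    congr 1
    apply Polynomial.funext; intro t; simp; ring
  have hU : U *
      PowerSeries.map (shift (1 / 2))
        (expS (-(Polynomial.C (1 / 2) * Polynomial.X + Polynomial.C (1 / 48)))) =
      expS (-(Polynomial.C (1 / 2) * Polynomial.X + Polynomial.C (1 / 48))) *
        (expS (Polynomial.C (-1 / 2)) ^ 2 * expS (-Polynomial.X) ^ 3) := by
    rw [hUdef, map_expS, expS_pow, expS_pow, ← expS_add, ← expS_add, ← expS_add]
    congr 1
    apply Polynomial.funext; intro t; simp; ring
  have h1 : expS (-(Polynomial.C ((1 : ℕ) / 2 : ℂ) * Polynomial.X +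
      Polynomial.C ((1 : ℕ) ^ 2 / 48 : ℂ))) =
      expS (-(Polynomial.C (1 / 2) * Polynomial.X + Polynomial.C (1 / 48))) := by
    simp
  have h5 : expS (-(Polynomial.C ((5 : ℕ) / 2 : ℂ) * Polynomial.X +
      Polynomial.C ((5 : ℕ) ^ 2 / 48 : ℂ))) =
      expS (-(Polynomial.C (1 / 2) * Polynomial.X + Polynomial.C (1 / 48))) *
        (expS (Polynomial.C (-1 / 2)) * expS (-Polynomial.X) ^ 2) := by
    rw [expS_pow, ← expS_add, ← expS_add]
    congr 1
    apply Polynomial.funext; intro t; simp; ring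
  rw [Finset.sum_pair (by norm_num), h1, h5] at hθ
  rw [map_sub, map_mul, map_zagierSum, hx, map_expS Polynomial.C, map_shift_expS_C]
  have hf := zagierSum_functional (expS (Polynomial.C (-1 / 2 : ℂ))) (expS (-Polynomial.X)) M
  rw [zagierSum_succ] at hf
  simp only [if_true, OfNat.ofNat_ne_one, if_false, map_one, map_neg, one_mul, neg_one_mul] at hθ
  set P := expS (Polynomial.C (-1 / 2 : ℂ))
  set x := expS (-Polynomial.X : ℂ[X])
  set E := expS (-(Polynomial.C (1 / 2 : ℂ) * Polynomial.X + Polynomial.C (1 / 48)))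
  have hP : constantCoeff P = 1 := constantCoeff_expS _
  have hX : constantCoeff x = 1 := constantCoeff_expS _
  -- `d1` handles the extra last term of the sum at `x`, `d2` the remainder of the functional
  -- equation.
  have d1 : (PowerSeries.X : ℂ[X]⟦X⟧) ^ K ∣ qPoch P x (M + 1) :=
    X_pow_dvd_qPoch (by rw [hP, one_pow]) (Or.inl hX) (by omega)
  have d2 : (PowerSeries.X : ℂ[X]⟦X⟧) ^ K ∣ qPoch P (P * x) (M + 1) :=
    X_pow_dvd_qPoch (by rw [hP, one_pow]) (Or.inl (by rw [map_mul, hP, hX, one_mul])) (by omega)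
  have d3 := (d1.mul_left (-(E * x ^ M))).add (d2.mul_left (-(E * x ^ (M + 1))))
  convert d3 using 1
  linear_combination E * hf - hθ + zagierSum P (P * x) M * hU

theorem thetaSer_congr_neg {ℓ : ℕ → ℂ}
    (h : IsRegularized ℓ 12 {1, 5, 7, 11} fun i => if i = 1 ∨ i = 5 then 1 else -1) {K M : ℕ}
    (hM : 2 * K ≤ M) :
    (PowerSeries.X : ℂ[X]⟦X⟧) ^ K ∣
      expS (-(Polynomial.C (1 / 2) * Polynomial.X + Polynomial.C (1 / 48))) *
        zagierSum (PowerSeries.map Polynomial.C (-expS (-1 / 2 : ℂ))) (expS (-Polynomial.X)) M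
        - thetaSer ℓ := by
  rw [show (12 : ℂ) = 12 * 1 by norm_num] at h
  have hθ := h.thetaSer_functional
  obtain ⟨U, hUdef⟩ : ∃ U : ℂ[X]⟦X⟧, U = expS (-(Polynomial.C (6 * 1) * Polynomial.X +
      Polynomial.C (3 * 1 ^ 2))) := ⟨_, rfl⟩
  rw [← hUdef] at hθ
  refine X_pow_dvd_of_shift (s := 1) (U := U) (by rw [hUdef, constantCoeff_expS]) ?_
  change _ ∣ _ + _ * PowerSeries.map (shift 1) _
  have hx : PowerSeries.map (shift 1) (expS (-Polynomial.X)) =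
      expS (Polynomial.C (-1 / 2)) ^ 2 * expS (-Polynomial.X) := by
    rw [map_expS, expS_pow, ← expS_add]
    congr 1
    apply Polynomial.funext; intro t; simp; ring
  have hU : U *
      PowerSeries.map (shift 1)
        (expS (-(Polynomial.C (1 / 2) * Polynomial.X + Polynomial.C (1 / 48)))) =
      expS (-(Polynomial.C (1 / 2) * Polynomial.X + Polynomial.C (1 / 48))) *
        (expS (Polynomial.C (-1 / 2)) ^ 7 * expS (-Polynomial.X) ^ 6) := by
    rw [hUdef, map_expS, expS_pow, expS_pow, ← expS_add, ← expS_add, ← expS_add]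
    congr 1
    apply Polynomial.funext; intro t; simp; ring
  -- For `n = 1, 5, 7, 11` these are the monomials `P^i x^j` on the right of
  -- `zagierSum_functional_two`; the signs come from `p = -P`.
  have hn : ∀ n i j : ℕ, n = 2 * j + 1 → n ^ 2 = 24 * i + 1 →
      expS (-(Polynomial.C (n / 2 : ℂ) * Polynomial.X + Polynomial.C (n ^ 2 / 48 : ℂ))) =
      expS (-(Polynomial.C (1 / 2) * Polynomial.X + Polynomial.C (1 / 48))) *
        (expS (Polynomial.C (-1 / 2)) ^ i * expS (-Polynomial.X) ^ j) := by
    intro n i j hj hi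
    rw [expS_pow, expS_pow, ← expS_add, ← expS_add]
    congr 1
    have hj' : (n : ℂ) = 2 * j + 1 := by exact_mod_cast hj
    have hi' : (n : ℂ) ^ 2 = 24 * i + 1 := by exact_mod_cast hi
    apply Polynomial.funext; intro t
    rw [hi', hj']
    simp; ring
  rw [Finset.sum_insert (by decide), Finset.sum_insert (by decide), Finset.sum_pair (by norm_num),
    hn 1 0 0 rfl rfl, hn 5 1 2 rfl rfl, hn 7 2 3 rfl rfl, hn 11 5 5 rfl rfl] at hθ
  rw [map_sub, map_mul, map_zagierSum, map_neg, map_neg, hx, map_expS Polynomial.C,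
    map_shift_expS_C]
  have hf := zagierSum_functional_two (-expS (Polynomial.C (-1 / 2 : ℂ))) (expS (-Polynomial.X)) M
  rw [zagierSum_succ, zagierSum_succ, neg_sq] at hf
  set P := expS (Polynomial.C (-1 / 2 : ℂ))
  set x := expS (-Polynomial.X : ℂ[X])
  set E := expS (-(Polynomial.C (1 / 2 : ℂ) * Polynomial.X + Polynomial.C (1 / 48)))
  norm_num at hθ
  have hP : constantCoeff P = 1 := constantCoeff_expS _
  have hX : constantCoeff x = 1 := constantCoeff_expS _
  have hP2 : constantCoeff (-P) ^ 2 = 1 := by rw [map_neg, hP, neg_one_sq]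
  have d1 (j : ℕ) : (PowerSeries.X : ℂ[X]⟦X⟧) ^ K ∣ qPoch (-P) x (M + j) :=
    X_pow_dvd_qPoch hP2 (Or.inl hX) (by omega)
  have d2 : (PowerSeries.X : ℂ[X]⟦X⟧) ^ K ∣ qPoch (-P) (-P * x) (M + 2) :=
    X_pow_dvd_qPoch hP2 (Or.inr (by simp [hP, hX])) (by omega)
  have d3 : (PowerSeries.X : ℂ[X]⟦X⟧) ^ K ∣ qPoch (-P) (-P * (-P * x)) (M + 1) :=
    X_pow_dvd_qPoch hP2 (Or.inl (by simp [hP, hX])) (by omega)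
  have d := ((((d1 1).mul_left (-(E * x ^ M))).add ((d1 2).mul_left (-(E * x ^ (M + 1))))).add
    (d2.mul_left (-(E * x ^ (M + 2))))).add
    (d3.mul_left (E * (P ^ 2 * x ^ 3 * (-P * x) ^ (M + 1))))
  convert d using 1
  linear_combination E * hf - hθ + zagierSum (-P) (P ^ 2 * x) M * hU

end StrangeIdentity

/-! ### Values of the `L`-functions at negative integers. -/

section LValues

/-- The value of `∑ χ(n) n ^ k`, regularized by Bernoulli polynomials. -/
noncomputable def regVal (χ : ZMod 24 → ℂ) (k : ℕ) : ℂ :=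
  -(24 ^ k / (k + 1)) * ∑ j ∈ Finset.Icc (1 : ℕ) 24,
    χ (j : ZMod 24) * aeval ((j : ℂ) / 24) (Polynomial.bernoulli (k + 1))

theorem regVal_sub (χ ψ : ZMod 24 → ℂ) (k : ℕ) :
    regVal (χ - ψ) k = regVal χ k - regVal ψ k := by
  simp only [regVal, Pi.sub_apply, sub_mul, Finset.sum_sub_distrib, mul_sub]

theorem regVal_add (χ ψ : ZMod 24 → ℂ) (k : ℕ) :
    regVal (χ + ψ) k = regVal χ k + regVal ψ k := by
  simp only [regVal, Pi.add_apply, add_mul, Finset.sum_add_distrib, mul_add]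

theorem sum_zmod_eq_sum_Icc (f : ZMod 24 → ℂ) :
    ∑ j : ZMod 24, f j = ∑ j ∈ Finset.Icc (1 : ℕ) 24, f (j : ZMod 24) := by
  symm
  refine Finset.sum_bij (fun j _ => (j : ZMod 24)) (fun _ _ => Finset.mem_univ _) ?_ ?_
    (fun _ _ => rfl)
  · intro a ha b hb h
    rw [Finset.mem_Icc] at ha hb
    have := (ZMod.natCast_eq_natCast_iff' a b 24).1 h
    omega
  · intro b _
    revert b
    decide

theorem LFunction_neg_nat (χ : ZMod 24 → ℂ) {k : ℕ} (hk : k ≠ 0) :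
    ZMod.LFunction χ (-k) = regVal χ k := by
  rw [ZMod.LFunction, sum_zmod_eq_sum_Icc, regVal, neg_neg, Complex.cpow_natCast, Finset.mul_sum,
    Finset.mul_sum]
  refine Finset.sum_congr rfl fun j hj => ?_
  rw [Finset.mem_Icc] at hj
  -- The residue class 0 is represented by `j = 24`, at the endpoint 1; this is allowed because `k ≠
  -- 0`.
  have hj' : ((j : ℝ) / 24) ∈ Set.Icc (0 : ℝ) 1 := by
    have : (j : ℝ) ≤ 24 := by exact_mod_cast hj.2
    constructor
    · positivity
    · rw [div_le_one (by norm_num)]; exact this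
  have h := HurwitzZeta.hurwitzZeta_neg_nat hk hj'
  rw [ZMod.toAddCircle_natCast]
  push_cast at h ⊢
  rw [h, Polynomial.eval_map_algebraMap]
  ring

theorem tSeries_eq (χ : ZMod 24 → ℂ) (n : ℕ) :
    tSeries χ n = 1 / 2 * (-1) ^ (n + 1) * regVal χ (2 * n + 1) := by
  rw [tSeries, ← LFunction_neg_nat χ (Nat.succ_ne_zero _)]
  push_cast
  ring_nf

/-- The generating function of Bernoulli polynomials, divided by its factor `24 z`. The `B_0` terms
would give a pole at `z = 0`; they cancel by `hχ`. -/
theorem mk_regVal_mul {χ : ZMod 24 → ℂ} (hχ : ∑ j ∈ Finset.Icc (1 : ℕ) 24, χ (j : ZMod 24) = 0) :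
    PowerSeries.mk (fun k => regVal χ k / k.factorial) * (expS 24 - 1) =
      -∑ j ∈ Finset.Icc (1 : ℕ) 24, PowerSeries.C (χ (j : ZMod 24)) * expS (j : ℂ) := by
  set B : ℕ → ℂ⟦X⟧ := fun j => rescale (24 : ℂ) (PowerSeries.mk fun n =>
    aeval ((j : ℂ) / 24) ((1 / n.factorial : ℚ) • Polynomial.bernoulli n)) with hB
  have hgen : ∀ j, B j * (expS 24 - 1) = 24 * PowerSeries.X * expS (j : ℂ) := by
    intro j
    have h := congrArg (rescale (24 : ℂ)) (bernoulli_generating_function ((j : ℂ) / 24))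
    rw [map_mul, map_mul, map_sub, map_one, rescale_X, rescale_rescale,
      div_mul_cancel₀ _ (by norm_num : (24 : ℂ) ≠ 0)] at h
    rw [expS, expS, show (24 : ℂ⟦X⟧) = PowerSeries.C 24 from (map_ofNat _ 24).symm]
    exact h
  have hL : 24 * PowerSeries.X * PowerSeries.mk (fun k => regVal χ k / k.factorial) =
      -∑ j ∈ Finset.Icc (1 : ℕ) 24, PowerSeries.C (χ (j : ZMod 24)) * B j := by
    ext1 k
    rw [mul_assoc, show (24 : ℂ⟦X⟧) = PowerSeries.C 24 from (map_ofNat _ 24).symm,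
      PowerSeries.coeff_C_mul, map_neg, map_sum]
    have hr (f : ℂ⟦X⟧) (n : ℕ) : PowerSeries.coeff n (rescale (24 : ℂ) f) =
        (24 : ℂ) ^ n * PowerSeries.coeff n f := coeff_rescale f 24 n
    simp only [PowerSeries.coeff_C_mul, hB, hr, PowerSeries.coeff_mk]
    rcases k with _ | k
    · simp [hχ]
    · rw [PowerSeries.coeff_succ_X_mul, PowerSeries.coeff_mk, regVal, Finset.mul_sum,
        Finset.sum_div, Finset.mul_sum, ← Finset.sum_neg_distrib]
      refine Finset.sum_congr rfl fun j _ => ?_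
      have h1 : (k.factorial : ℂ) ≠ 0 := by exact_mod_cast k.factorial_ne_zero
      have h2 : (k + 1 : ℂ) ≠ 0 := by exact_mod_cast k.succ_ne_zero
      rw [map_smul, Nat.factorial_succ, Rat.smul_def]
      push_cast
      field_simp
      ring
  have h24 : (24 * PowerSeries.X : ℂ⟦X⟧) ≠ 0 :=
    mul_ne_zero (fun h => by
      have h0 := congrArg PowerSeries.constantCoeff h
      rw [map_ofNat, map_zero] at h0
      norm_num at h0) PowerSeries.X_ne_zero
  refine mul_left_cancel₀ h24 ?_
  rw [← mul_assoc, hL, neg_mul, Finset.sum_mul, mul_neg, Finset.mul_sum]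
  congr 1
  refine Finset.sum_congr rfl fun j _ => ?_
  rw [mul_assoc, hgen]
  ring

theorem expS_ne_one {a : ℂ} (ha : a ≠ 0) : expS a - 1 ≠ 0 := by
  intro h
  have := congrArg (PowerSeries.coeff 1) h
  simp [coeff_expS, PowerSeries.coeff_one] at this
  exact ha this

theorem expS_natCast_eq_pow (n : ℕ) : expS (n : ℂ) = expS 1 ^ n := by
  rw [expS_pow, mul_one]

theorem isRegularized_sub :
    IsRegularized (regVal (chi1 - chi0)) 6 {1, 5} fun i => if i = 1 then 1 else -1 := by
  have h := mk_regVal_mul (χ := chi1 - chi0)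
    (by simp +decide [Finset.sum_Icc_succ_top, chi0, chi1])
  have e6 : expS (6 : ℂ) = expS 1 ^ 6 := by exact_mod_cast expS_natCast_eq_pow 6
  have e24 : expS (24 : ℂ) = expS 1 ^ 24 := by exact_mod_cast expS_natCast_eq_pow 24
  have h6 := expS_ne_one (a := 6) (by norm_num)
  have h12 : (1 + expS 1 ^ 12 : ℂ⟦X⟧) ≠ 0 := by
    intro h
    have := congrArg PowerSeries.constantCoeff h
    norm_num [constantCoeff_expS] at this
  rw [e24] at h
  rw [e6] at h6
  simp only [expS_natCast_eq_pow] at h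
  simp +decide [Finset.sum_Icc_succ_top, chi0, chi1] at h
  rw [IsRegularized, Finset.sum_pair (by norm_num), e6, expS_natCast_eq_pow, expS_natCast_eq_pow]
  -- `e^{24z} - 1 = (1 + e^{6z})(e^{6z} - 1)(1 + e^{12z})`.
  refine mul_right_cancel₀ (mul_ne_zero h6 h12) ?_
  simp +decide only [if_true, if_false, map_one, map_neg]
  linear_combination h

theorem isRegularized_add :
    IsRegularized (regVal (chi1 + chi0)) 12 {1, 5, 7, 11}
      fun i => if i = 1 ∨ i = 5 then 1 else -1 := by
  have h := mk_regVal_mul (χ := chi1 + chi0)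
    (by simp +decide [Finset.sum_Icc_succ_top, chi0, chi1])
  have e12 : expS (12 : ℂ) = expS 1 ^ 12 := by exact_mod_cast expS_natCast_eq_pow 12
  have e24 : expS (24 : ℂ) = expS 1 ^ 24 := by exact_mod_cast expS_natCast_eq_pow 24
  have h12 := expS_ne_one (a := 12) (by norm_num)
  rw [e24] at h
  rw [e12] at h12
  simp only [expS_natCast_eq_pow] at h
  simp +decide [Finset.sum_Icc_succ_top, chi0, chi1] at h
  rw [IsRegularized, Finset.sum_insert (by decide), Finset.sum_insert (by decide),
    Finset.sum_pair (by norm_num), e12]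
  simp only [expS_natCast_eq_pow]
  refine mul_right_cancel₀ h12 ?_
  simp +decide only [if_true, if_false, map_one, map_neg]
  linear_combination h

end LValues

/-! ### The expansions in `ℂ⟦z⟧`. -/

section FormalExpansion

theorem halfDerivSer_regVal (χ : ZMod 24 → ℂ) :
    halfDerivSer (regVal χ) =
      PowerSeries.mk fun n => tSeries χ n / (n.factorial : ℂ) * (1 / 48) ^ n := by
  simp only [halfDerivSer, tSeries_eq]

theorem halfDerivSer_sub (χ ψ : ZMod 24 → ℂ) : halfDerivSer (regVal (χ - ψ)) =
    halfDerivSer (regVal χ) - halfDerivSer (regVal ψ) := by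
  ext1 k
  simp only [halfDerivSer, regVal_sub, map_sub, PowerSeries.coeff_mk]
  ring

theorem halfDerivSer_add (χ ψ : ZMod 24 → ℂ) : halfDerivSer (regVal (χ + ψ)) =
    halfDerivSer (regVal χ) + halfDerivSer (regVal ψ) := by
  ext1 k
  simp only [halfDerivSer, regVal_add, map_add, PowerSeries.coeff_mk]
  ring

theorem X_pow_dvd_half_of_dvd_two_mul {K : ℕ} {f : ℂ⟦X⟧}
    (h : (PowerSeries.X : ℂ⟦X⟧) ^ K ∣ 2 * f) : (PowerSeries.X : ℂ⟦X⟧) ^ K ∣ f := by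
  have h2 : (PowerSeries.C (1 / 2 : ℂ)) * 2 = 1 := by
    rw [show (2 : ℂ⟦X⟧) = PowerSeries.C 2 from (map_ofNat _ 2).symm, ← map_mul]
    norm_num
  have := h.mul_left (PowerSeries.C (1 / 2 : ℂ))
  rwa [← mul_assoc, h2, one_mul] at this

theorem X_pow_dvd_partial_sums {K M : ℕ} (hM : K + 1 ≤ M) :
    (PowerSeries.X : ℂ⟦X⟧) ^ K ∣ expS (25 / 48) * halfDerivSer (regVal chi0) -
        ∑ n ∈ Finset.range M, aeval (expS (-1)) (term0 n) ∧
      (PowerSeries.X : ℂ⟦X⟧) ^ K ∣ expS (1 / 48) * halfDerivSer (regVal chi1) -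
        ∑ n ∈ Finset.range M, aeval (expS (-1)) (term1 n) := by
  have hpos := X_pow_dvd_sum_qPoch_sub
    (thetaSer_congr_pos isRegularized_sub (K := K + 1) (M := 2 * M) (by omega))
  have hneg := X_pow_dvd_sum_qPoch_sub
    (thetaSer_congr_neg isRegularized_add (K := K + 1) (M := 2 * M) (by omega))
  rw [← sum_aeval_term1_sub_term0, halfDerivSer_sub] at hpos
  rw [← sum_aeval_term1_sub_term0, neg_sq, halfDerivSer_add] at hneg
  have hq : expS (-1 / 2 : ℂ) ^ 2 = expS (-1) := by
    rw [expS_pow]; congr 1; norm_num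
  have hE : expS (-1 / 2 : ℂ) * expS (1 / 2) = 1 := by
    rw [← expS_add, ← expS_zero]; congr 1; norm_num
  have hE' : expS (25 / 48 : ℂ) = expS (1 / 48) * expS (1 / 2) := by
    rw [← expS_add]; congr 1; norm_num
  rw [hq] at hpos hneg
  constructor
  · refine X_pow_dvd_half_of_dvd_two_mul ?_
    -- The difference carries `X⁽⁰⁾` with the factor `2 e^{-z/2}`; removing `e^{-z/2}` turns
    -- `e^{z/48}` into `e^{25z/48}`.
    convert (dvd_sub hneg hpos).mul_left (-expS (1 / 2)) using 1
    rw [hE']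
    linear_combination (2 * ∑ n ∈ Finset.range M, aeval (expS (-1 : ℂ)) (term0 n)) * hE
  · refine X_pow_dvd_half_of_dvd_two_mul ?_
    convert (dvd_add hpos hneg).mul_left (-1) using 1
    ring

end FormalExpansion

/-! ### From formal to asymptotic expansions. -/

section Asymptotics

open Asymptotics

/-- The filter `z ↘ 0`. -/
abbrev atZero : Filter ℝ := nhdsWithin 0 (Set.Ioi 0)

/-- `F` is the asymptotic expansion of `f` as `z ↘ 0`. -/
def Represents (f : ℝ → ℂ) (F : ℂ⟦X⟧) : Prop :=
  ∀ N : ℕ, ∃ P : ℂ[X], (PowerSeries.X : ℂ⟦X⟧) ^ N ∣ F - P ∧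
    (fun z : ℝ => f z - P.eval (z : ℂ)) =O[atZero] fun z : ℝ => z ^ N

theorem isBigO_one_of_continuous {f : ℝ → ℂ} (hf : Continuous f) :
    f =O[atZero] fun _ => (1 : ℝ) :=
  (hf.tendsto 0).isBigO_one ℝ |>.mono nhdsWithin_le_nhds

theorem continuous_eval_ofReal (P : ℂ[X]) : Continuous fun z : ℝ => P.eval (z : ℂ) :=
  P.continuous.comp Complex.continuous_ofReal

theorem pow_isBigO_one (N : ℕ) : (fun z : ℝ => z ^ N) =O[atZero] fun _ => (1 : ℝ) :=
  ((continuous_pow N).tendsto 0).isBigO_one ℝ |>.mono nhdsWithin_le_nhds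

theorem represents_polynomial (P : ℂ[X]) : Represents (fun z => P.eval (z : ℂ)) P :=
  fun N => ⟨P, by simp, by simpa using isBigO_zero _ _⟩

theorem Represents.add {f g : ℝ → ℂ} {F G : ℂ⟦X⟧} (hf : Represents f F) (hg : Represents g G) :
    Represents (fun z => f z + g z) (F + G) := by
  intro N
  obtain ⟨P, hP, hP'⟩ := hf N
  obtain ⟨Q, hQ, hQ'⟩ := hg N
  refine ⟨P + Q, ?_, ?_⟩
  · convert dvd_add hP hQ using 1
    push_cast
    ring
  · refine (hP'.add hQ').congr_left fun z => ?_
    rw [Polynomial.eval_add]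
    ring

theorem Represents.mul {f g : ℝ → ℂ} {F G : ℂ⟦X⟧} (hf : Represents f F) (hg : Represents g G) :
    Represents (fun z => f z * g z) (F * G) := by
  intro N
  obtain ⟨P, hP, hP'⟩ := hf N
  obtain ⟨Q, hQ, hQ'⟩ := hg N
  refine ⟨P * Q, ?_, ?_⟩
  · convert (hP.mul_right G).add (hQ.mul_left (P : ℂ⟦X⟧)) using 1
    push_cast
    ring
  · have hg1 : g =O[atZero] fun _ => (1 : ℝ) := by
      refine ((hQ'.trans (pow_isBigO_one N)).add
        (isBigO_one_of_continuous (continuous_eval_ofReal Q))).congr_left fun z => ?_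
      ring
    have h1 := (hP'.mul hg1).add
      ((isBigO_one_of_continuous (continuous_eval_ofReal P)).mul hQ' |>.congr_right
        (g₂ := fun z : ℝ => z ^ N * 1) fun z => mul_comm _ _)
    simp only [mul_one] at h1
    refine h1.congr_left fun z => ?_
    rw [Polynomial.eval_mul]
    ring

theorem represents_const (a : ℂ) : Represents (fun _ => a) (PowerSeries.C a) := by
  simpa using represents_polynomial (Polynomial.C a)

theorem Represents.sub {f g : ℝ → ℂ} {F G : ℂ⟦X⟧} (hf : Represents f F) (hg : Represents g G) :
    Represents (fun z => f z - g z) (F - G) := by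
  convert hf.add ((represents_const (-1)).mul hg) using 1
  · ext z; ring
  · rw [map_neg, map_one]; ring

theorem Represents.sum {ι : Type*} (s : Finset ι) {f : ι → ℝ → ℂ} {F : ι → ℂ⟦X⟧}
    (h : ∀ i ∈ s, Represents (f i) (F i)) :
    Represents (fun z => ∑ i ∈ s, f i z) (∑ i ∈ s, F i) := by
  classical
  induction s using Finset.induction_on with
  | empty => simpa using represents_const 0
  | insert i s hi ih =>
    simp only [Finset.sum_insert hi]
    exact (h i (Finset.mem_insert_self i s)).add
      (ih fun j hj => h j (Finset.mem_insert_of_mem hj))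

theorem Represents.pow {f : ℝ → ℂ} {F : ℂ⟦X⟧} (h : Represents f F) (n : ℕ) :
    Represents (fun z => f z ^ n) (F ^ n) := by
  induction n with
  | zero => simpa using represents_const 1
  | succ n ih => simpa only [pow_succ] using ih.mul h

theorem Represents.aeval {f : ℝ → ℂ} {F : ℂ⟦X⟧} (h : Represents f F) (p : ℤ[X]) :
    Represents (fun z => Polynomial.aeval (f z) p) (Polynomial.aeval F p) := by
  induction p using Polynomial.induction_on' with
  | add p q hp hq => simpa only [map_add] using hp.add hq
  | monomial n a =>
    simp only [Polynomial.aeval_monomial]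
    refine Represents.mul ?_ (h.pow n)
    simpa using represents_const (a : ℂ)

theorem eval_trunc (F : ℂ⟦X⟧) (N : ℕ) (w : ℂ) :
    (PowerSeries.trunc N F).eval w =
      ∑ i ∈ Finset.range N, PowerSeries.coeff i F * w ^ i := by
  exact eval₂_trunc_eq_sum_range w (RingHom.id ℂ) N F

theorem represents_exp (c : ℂ) : Represents (fun z => Complex.exp (c * z)) (expS c) := by
  intro N
  refine ⟨PowerSeries.trunc N (expS c), ?_, ?_⟩
  · rw [PowerSeries.X_pow_dvd_iff]
    intro m hm
    simp [Polynomial.coeff_coe, PowerSeries.coeff_trunc, hm]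
  · have h1 : (fun w : ℂ => Complex.exp w - ∑ i ∈ Finset.range N, w ^ i / i.factorial)
        =O[nhds 0] fun w => w ^ N := by
      rcases Nat.eq_zero_or_pos N with rfl | hN
      · simpa using (Complex.continuous_exp.tendsto 0).isBigO_one ℂ
      · refine IsBigO.of_bound (N.succ * (N.factorial * N : ℝ)⁻¹) ?_
        filter_upwards [Metric.closedBall_mem_nhds (0 : ℂ) one_pos] with w hw
        rw [mem_closedBall_zero_iff] at hw
        have := Complex.exp_bound hw hN
        rw [norm_pow]
        linarith
    have h2 : Filter.Tendsto (fun z : ℝ => c * (z : ℂ)) atZero (nhds 0) := by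
      have : Continuous fun z : ℝ => c * (z : ℂ) := by fun_prop
      simpa using (this.tendsto 0).mono_left nhdsWithin_le_nhds
    have h3 := h1.comp_tendsto h2
    have h4 : ((fun w : ℂ => w ^ N) ∘ fun z : ℝ => c * (z : ℂ)) =O[atZero] fun z : ℝ => z ^ N := by
      refine IsBigO.of_bound (‖c‖ ^ N) (Filter.Eventually.of_forall fun z => ?_)
      simp [mul_pow]
    refine (h3.trans h4).congr_left fun z => ?_
    simp only [Function.comp_apply]
    rw [eval_trunc]
    congr 1
    refine Finset.sum_congr rfl fun i _ => ?_
    rw [coeff_expS, mul_pow]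
    simp
    ring

/-- This transfers formal divisibility to an estimate: the approximating polynomial is itself
divisible by `z^N`. -/
theorem Represents.isBigO {f : ℝ → ℂ} {F : ℂ⟦X⟧} (h : Represents f F) {N : ℕ}
    (hF : (PowerSeries.X : ℂ⟦X⟧) ^ N ∣ F) : f =O[atZero] fun z : ℝ => z ^ N := by
  obtain ⟨P, hP, hP'⟩ := h N
  have hP1 : (PowerSeries.X : ℂ⟦X⟧) ^ N ∣ (P : ℂ⟦X⟧) := by
    simpa using dvd_sub hF hP
  have hP2 : (Polynomial.X : ℂ[X]) ^ N ∣ P := by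
    rw [Polynomial.X_pow_dvd_iff]
    intro d hd
    simpa using PowerSeries.X_pow_dvd_iff.1 hP1 d hd
  obtain ⟨Q, rfl⟩ := hP2
  have h1 : (fun z : ℝ => (z : ℂ) ^ N) =O[atZero] fun z : ℝ => z ^ N :=
    IsBigO.of_bound 1 (Filter.Eventually.of_forall fun z => by simp)
  have h2 := h1.mul (isBigO_one_of_continuous (continuous_eval_ofReal Q))
  simp only [mul_one] at h2
  refine (hP'.add h2).congr_left fun z => ?_
  simp

end Asymptotics

theorem X_pow_dvd_aeval_qProd_mul (n : ℕ) (r : ℤ[X]) :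
    (PowerSeries.X : ℂ⟦X⟧) ^ n ∣ Polynomial.aeval (expS (-1)) (qProd n * r) := by
  rw [map_mul]
  refine Dvd.dvd.mul_right ?_ _
  rw [qProd, map_prod]
  conv_lhs => rw [← Finset.card_range n, ← Finset.prod_const]
  refine Finset.prod_dvd_prod_of_dvd _ _ fun k _ => ?_
  rw [PowerSeries.X_dvd_iff]
  simp [constantCoeff_expS]

theorem X_pow_dvd_sub_sum_range_of_le {F : ℂ⟦X⟧} {f : ℕ → ℂ⟦X⟧} {N M M' : ℕ}
    (hf : ∀ n, (PowerSeries.X : ℂ⟦X⟧) ^ n ∣ f n) (hN : N ≤ M) (hM : M ≤ M')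
    (h : (PowerSeries.X : ℂ⟦X⟧) ^ N ∣ F - ∑ n ∈ Finset.range M', f n) :
    (PowerSeries.X : ℂ⟦X⟧) ^ N ∣ F - ∑ n ∈ Finset.range M, f n := by
  rw [← Finset.sum_range_add_sum_Ico _ hM] at h
  have h2 : (PowerSeries.X : ℂ⟦X⟧) ^ N ∣ ∑ n ∈ Finset.Ico M M', f n :=
    Finset.dvd_sum fun n hn =>
      (pow_dvd_pow _ (hN.trans (Finset.mem_Ico.1 hn).1)).trans (hf n)
  convert dvd_add h h2 using 1
  ring

theorem hasExpansion_of_dvd {p : ℕ → ℤ[X]} {c : ℂ} {a : ℕ → ℂ} (r : ℕ → ℤ[X])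
    (hp : ∀ n, p n = qProd n * r n)
    (h : ∀ K M : ℕ, K + 1 ≤ M → (PowerSeries.X : ℂ⟦X⟧) ^ K ∣
      expS c * PowerSeries.mk a - ∑ n ∈ Finset.range M, Polynomial.aeval (expS (-1)) (p n)) :
    HasExpansion p c a := by
  refine ⟨fun N => ⟨N + 1, fun M hM => h N M hM⟩, fun N M hM => ?_⟩
  -- The hypothesis `h` needs at least `N + 1` terms. It is applied to `M + 1` terms, and the last
  -- one, divisible by `z^M`, is dropped; this covers `M = N`.
  have hdvd := X_pow_dvd_sub_sum_range_of_le
    (fun n => by rw [hp]; exact X_pow_dvd_aeval_qProd_mul n (r n)) hM (Nat.le_succ M)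
    (h N (M + 1) (by omega))
  have htrunc : (PowerSeries.X : ℂ⟦X⟧) ^ N ∣
      PowerSeries.mk a - (PowerSeries.trunc N (PowerSeries.mk a) : ℂ[X]) := by
    rw [PowerSeries.X_pow_dvd_iff]
    intro m hm
    simp [Polynomial.coeff_coe, PowerSeries.coeff_trunc, hm]
  have hrep := (Represents.sum (Finset.range M) fun n _ => (represents_exp (-1)).aeval (p n)).sub
    ((represents_exp c).mul (represents_polynomial (PowerSeries.trunc N (PowerSeries.mk a))))
  have hO := hrep.isBigO (N := N) (by
    convert ((htrunc.mul_left (expS c)).sub hdvd) using 1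
    ring)
  refine hO.congr_left fun z => ?_
  rw [eval_trunc]
  simp

end Santos

theorem theorem1 :
    Santos.HasExpansion Santos.term0 (25 / 48)
      (fun n => Santos.tSeries Santos.chi0 n / (n.factorial : ℂ) * (1 / 48) ^ n) ∧
    Santos.HasExpansion Santos.term1 (1 / 48)
      (fun n => Santos.tSeries Santos.chi1 n / (n.factorial : ℂ) * (1 / 48) ^ n) ∧
    (∀ χ ∈ ({Santos.chi0, Santos.chi1} : Set (ZMod 24 → ℂ)), ∀ n : ℕ,
      Santos.tSeries χ n =
        1 / 2 * (-1) ^ n * (24 ^ (2 * n + 1) / (2 * (n : ℂ) + 2)) *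
          ∑ k ∈ Finset.Icc (1 : ℕ) 24,
            χ (k : ZMod 24) * Polynomial.aeval ((k : ℂ) / 24) (Polynomial.bernoulli (2 * n + 2))) := by
  refine ⟨Santos.hasExpansion_of_dvd _ (fun _ => rfl) fun K M hM => ?_,
    Santos.hasExpansion_of_dvd _ (fun _ => rfl) fun K M hM => ?_, fun χ _ n => ?_⟩
  · rw [← Santos.halfDerivSer_regVal]
    exact (Santos.X_pow_dvd_partial_sums hM).1
  · rw [← Santos.halfDerivSer_regVal]
    exact (Santos.X_pow_dvd_partial_sums hM).2
  · rw [Santos.tSeries_eq, Santos.regVal]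
    push_cast
    rw [show (2 * (n : ℂ) + 1 + 1) = 2 * n + 2 by ring]
    ring
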